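/- Let $n,m\ge 0$ and $N=nm$. Vectorize an $n\times m$ image column by column as $u\in\mathbb R^{N}$, and let $P\in\mathbb R^{N\times N}$ be the permutation matrix for which $Pu$ is the row-by-row vectorization of the same image. Let $D\in\mathbb R^{N\times N}$ be the upper bidiagonal matrix with $1$ on the diagonal and $-1$ on the superdiagonal. Let each of $D_x,D_y$ be obtained from $D$ by replacing an arbitrary, possibly empty, set of rows by zero rows. (In particular $D_x=D_y=D$ is allowed, and so is the homogeneous Neumann choice, in which the rows of $D_x$ belonging to the last pixel of each image column and the rows of $D_y$ belonging to the last pixel of each image row are zero.) Let $b\in\mathbb R^{N}$, $\lambda\ge 0$, $\mu_1,\mu_2>0$, and consider the anisotropic total variation denoising problem $$\min_u\ \lambda\big(\|D_xu\|_1+\|D_yPu\|_1\big)+\tfrac12\|u-b\|_2^2 \tag{1}$$ and its split form $$\min_{d_x,d_y,u,v}\ \lambda(\|d_x\|_1+\|d_y\|_1)+\tfrac12\|u-b\|_2^2\quad\text{s.t.}\quad d_x=D_xu,\ d_y=D_yv,\ v=Pu. \tag{2}$$ Put $\mathcal T(x,\tau)_i=\max\{|x_i|-\tau,0\}\,\mathrm{sign}(x_i)$.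 Given arbitrary $d_x^0,d_y^0,u^0,v^0,\gamma_x^0,\gamma_y^0,\gamma_z^0\in\mathbb R^N$, the ADAL iteration is, for $k=0,1,2,\dots$, \begin{align*} d_x^{k+1}&=\mathcal T(D_xu^k+\mu_1\gamma_x^k,\lambda\mu_1),\\ \big(D_y^TD_y+\tfrac{\mu_1}{\mu_2}I\big)v^{k+1}&=D_y^T(d_y^k-\mu_1\gamma_y^k)+\mu_1\gamma_z^k+\tfrac{\mu_1}{\mu_2}Pu^k,\\ d_y^{k+1}&=\mathcal T(D_yv^{k+1}+\mu_1\gamma_y^k,\lambda\mu_1),\\ \big(D_x^TD_x+(\tfrac{\mu_1}{\mu_2}+\mu_1)I\big)u^{k+1}&=\mu_1b+D_x^T(d_x^{k+1}-\mu_1\gamma_x^k)+P^T\big(\tfrac{\mu_1}{\mu_2}v^{k+1}-\mu_1\gamma_z^k\big),\\ \gamma_x^{k+1}&=\gamma_x^k+\tfrac1{\mu_1}(D_xu^{k+1}-d_x^{k+1}),\\ \gamma_y^{k+1}&=\gamma_y^k+\tfrac1{\mu_1}(D_yv^{k+1}-d_y^{k+1}),\\ \gamma_z^{k+1}&=\gamma_z^k+\tfrac1{\mu_2}(Pu^{k+1}-v^{k+1}).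 \end{align*} Then the coefficient matrices of the two linear systems are positive definite and tridiagonal, and for every starting point the iteration determines exactly one sequence. For every starting point this sequence $(d_x^k,d_y^k,u^k,v^k,\gamma_x^k,\gamma_y^k,\gamma_z^k)$ converges to a limit $(d_x^*,d_y^*,u^*,v^*,\gamma_x^*,\gamma_y^*,\gamma_z^*)$ which is a Kuhn–Tucker pair of (2), that is, $$d_x^*=D_xu^*,\quad d_y^*=D_yv^*,\quad v^*=Pu^*,\qquad \gamma_x^*\in\partial(\lambda\|\cdot\|_1)(d_x^*),\quad \gamma_y^*\in\partial(\lambda\|\cdot\|_1)(d_y^*),$$ $$-(D_x^T\gamma_x^*+P^T\gamma_z^*)\in\partial\big(\tfrac12\|\cdot-b\|_2^2\big)(u^*),\qquad D_y^T\gamma_y^*-\gamma_z^*=0.$$ Moreover $(d_x^*,d_y^*,u^*,v^*)$ is an optimal solution of (2), $u^*$ is the unique minimizer of (1), and the returned images $\tfrac12(u^k+P^Tv^k)$ converge to $u^*$. -/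

import Mathlib

open Filter Topology
open scoped Matrix

namespace TVDenoise

/-- Column-major numbering of the pixels of an `n × m` image: pixel `(i, j)` (row `i`, column `j`)
gets the (zero-based) index `i + n * j`. -/
def colMajor (n m : ℕ) : Fin n × Fin m ≃ Fin (n * m) :=
  (Equiv.prodComm (Fin n) (Fin m)).trans (finProdFinEquiv.trans (finCongr (Nat.mul_comm m n)))

/-- Row-major numbering of the pixels of an `n × m` image: pixel `(i, j)` gets the (zero-based)
index `j + m * i`. -/
def rowMajor (n m : ℕ) : Fin n × Fin m ≃ Fin (n * m) :=
  finProdFinEquiv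

/-- The permutation matrix `P` which sends the column-major vectorization of an image to its
row-major vectorization. -/
def reorder (n m : ℕ) : Matrix (Fin (n * m)) (Fin (n * m)) ℝ :=
  Equiv.Perm.permMatrix ℝ ((rowMajor n m).symm.trans (colMajor n m))

/-- The upper bidiagonal `N × N` matrix with `1` on the diagonal and `-1` on the superdiagonal, in
which the rows with index in `S` are replaced by zero rows. The choice `S = ∅` is the plain
bidiagonal matrix; the choices `columnEnds` and `rowEnds` below impose the homogeneous Neumann
condition at the image boundary. -/
def diffMatrix (N : ℕ) (S : Finset (Fin N)) : Matrix (Fin N) (Fin N) ℝ :=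
  Matrix.of fun k l =>
    if k ∈ S then 0
    else if l = k then 1
    else if l.val = k.val + 1 then -1
    else 0

/-- Column-major indices of the last pixel of every image column. -/
def columnEnds (n m : ℕ) : Finset (Fin (n * m)) :=
  Finset.univ.filter fun k => ((colMajor n m).symm k).1.val + 1 = n

/-- Row-major indices of the last pixel of every image row. -/
def rowEnds (n m : ℕ) : Finset (Fin (n * m)) :=
  Finset.univ.filter fun k => ((rowMajor n m).symm k).2.val + 1 = m

/-- The `ℓ¹` norm. -/
def l1Norm {N : ℕ} (x : Fin N → ℝ) : ℝ := ∑ k, |x k|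

/-- The square of the `ℓ²` norm. -/
def sqNorm {N : ℕ} (x : Fin N → ℝ) : ℝ := ∑ k, x k ^ 2

/-- The anisotropic total variation `‖∇ₓu‖₁ + ‖∇_y u‖₁` with `∇ₓu = Dx u` and
`∇_y u = Dy (P u)`. -/
def anisoTV {N : ℕ} (Dx Dy P : Matrix (Fin N) (Fin N) ℝ) (u : Fin N → ℝ) : ℝ :=
  l1Norm (Dx *ᵥ u) + l1Norm (Dy *ᵥ (P *ᵥ u))

/-- The objective of the total variation denoising problem. -/
noncomputable def tvObjective {N : ℕ} (lam : ℝ) (b : Fin N → ℝ)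
    (Dx Dy P : Matrix (Fin N) (Fin N) ℝ) (u : Fin N → ℝ) : ℝ :=
  lam * anisoTV Dx Dy P u + 1 / 2 * sqNorm (u - b)

/-- Primal variables `dx, dy, u, v` and multipliers `gx, gy, gz`
of the constraints `dx = Dx u`, `dy = Dy v`, `v = P u`. -/
@[ext] structure State (N : ℕ) where
  dx : Fin N → ℝ
  dy : Fin N → ℝ
  u : Fin N → ℝ
  v : Fin N → ℝ
  gx : Fin N → ℝ
  gy : Fin N → ℝ
  gz : Fin N → ℝ

/-- The constraints of the split problem. -/
def IsFeasible {N : ℕ} (Dx Dy P : Matrix (Fin N) (Fin N) ℝ) (z : State N) : Prop :=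
  z.dx = Dx *ᵥ z.u ∧ z.dy = Dy *ᵥ z.v ∧ z.v = P *ᵥ z.u

/-- The objective of the split problem. -/
noncomputable def splitObjective {N : ℕ} (lam : ℝ) (b : Fin N → ℝ) (z : State N) : ℝ :=
  lam * (l1Norm z.dx + l1Norm z.dy) + 1 / 2 * sqNorm (z.u - b)

/-- The primal part of `z` is an optimal solution of the split problem. -/
def IsSplitSolution {N : ℕ} (lam : ℝ) (b : Fin N → ℝ)
    (Dx Dy P : Matrix (Fin N) (Fin N) ℝ) (z : State N) : Prop :=
  IsFeasible Dx Dy P z ∧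
    ∀ z' : State N, IsFeasible Dx Dy P z' → splitObjective lam b z ≤ splitObjective lam b z'

/-- `g` is a subgradient of `F` at `x`. -/
def IsSubgradient {N : ℕ} (F : (Fin N → ℝ) → ℝ) (x g : Fin N → ℝ) : Prop :=
  ∀ y, F x + g ⬝ᵥ (y - x) ≤ F y

/-- The Kuhn–Tucker conditions of the split problem: feasibility, and zero is a subgradient, with
respect to each of `dx`, `dy`, `u`, `v`, of the Lagrangian
`λ(‖dx‖₁ + ‖dy‖₁) + ½‖u - b‖² + gxᵀ(Dx u - dx) + gyᵀ(Dy v - dy) + gzᵀ(P u - v)`. -/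
def IsKuhnTucker {N : ℕ} (lam : ℝ) (b : Fin N → ℝ)
    (Dx Dy P : Matrix (Fin N) (Fin N) ℝ) (z : State N) : Prop :=
  IsFeasible Dx Dy P z ∧
  IsSubgradient (fun d => lam * l1Norm d) z.dx z.gx ∧
  IsSubgradient (fun d => lam * l1Norm d) z.dy z.gy ∧
  IsSubgradient (fun u => 1 / 2 * sqNorm (u - b)) z.u (-(Dxᵀ *ᵥ z.gx + Pᵀ *ᵥ z.gz)) ∧
  Dyᵀ *ᵥ z.gy - z.gz = 0

/-- Componentwise soft thresholding. -/
noncomputable def softThreshold {N : ℕ} (x : Fin N → ℝ) (τ : ℝ) : Fin N → ℝ :=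
  fun k => max (|x k| - τ) 0 * Real.sign (x k)

/-- Coefficient matrix of the linear system for `u`. -/
noncomputable def uMatrix {N : ℕ} (μ₁ μ₂ : ℝ) (Dx : Matrix (Fin N) (Fin N) ℝ) :
    Matrix (Fin N) (Fin N) ℝ :=
  Dxᵀ * Dx + (μ₁ / μ₂ + μ₁) • (1 : Matrix (Fin N) (Fin N) ℝ)

/-- Coefficient matrix of the linear system for `v`. -/
noncomputable def vMatrix {N : ℕ} (μ₁ μ₂ : ℝ) (Dy : Matrix (Fin N) (Fin N) ℝ) :
    Matrix (Fin N) (Fin N) ℝ :=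
  Dyᵀ * Dy + (μ₁ / μ₂) • (1 : Matrix (Fin N) (Fin N) ℝ)

/-- All entries off the three central diagonals vanish. -/
def IsTridiagonal {N : ℕ} (M : Matrix (Fin N) (Fin N) ℝ) : Prop :=
  ∀ k l : Fin N, (k.val + 1 < l.val ∨ l.val + 1 < k.val) → M k l = 0

/-- One iteration of the alternating direction augmented Lagrangian method, from `w` to `w'`. -/
structure IsADALStep {N : ℕ} (lam μ₁ μ₂ : ℝ) (b : Fin N → ℝ)
    (Dx Dy P : Matrix (Fin N) (Fin N) ℝ) (w w' : State N) : Prop where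
  dx_eq : w'.dx = softThreshold (Dx *ᵥ w.u + μ₁ • w.gx) (lam * μ₁)
  v_eq : vMatrix μ₁ μ₂ Dy *ᵥ w'.v =
    Dyᵀ *ᵥ (w.dy - μ₁ • w.gy) + μ₁ • w.gz + (μ₁ / μ₂) • (P *ᵥ w.u)
  dy_eq : w'.dy = softThreshold (Dy *ᵥ w'.v + μ₁ • w.gy) (lam * μ₁)
  u_eq : uMatrix μ₁ μ₂ Dx *ᵥ w'.u =
    μ₁ • b + Dxᵀ *ᵥ (w'.dx - μ₁ • w.gx) + Pᵀ *ᵥ ((μ₁ / μ₂) • w'.v - μ₁ • w.gz)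
  gx_eq : w'.gx = w.gx + (1 / μ₁) • (Dx *ᵥ w'.u - w'.dx)
  gy_eq : w'.gy = w.gy + (1 / μ₁) • (Dy *ᵥ w'.v - w'.dy)
  gz_eq : w'.gz = w.gz + (1 / μ₂) • (P *ᵥ w'.u - w'.v)

/-- A sequence of iterates of the method. -/
def IsADALRun {N : ℕ} (lam μ₁ μ₂ : ℝ) (b : Fin N → ℝ)
    (Dx Dy P : Matrix (Fin N) (Fin N) ℝ) (w : ℕ → State N) : Prop :=
  ∀ k, IsADALStep lam μ₁ μ₂ b Dx Dy P (w k) (w (k + 1))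

/-- Convergence of all primal variables and all multipliers. -/
def ConvergesTo {N : ℕ} (w : ℕ → State N) (z : State N) : Prop :=
  Tendsto (fun k => (w k).dx) atTop (𝓝 z.dx) ∧
  Tendsto (fun k => (w k).dy) atTop (𝓝 z.dy) ∧
  Tendsto (fun k => (w k).u) atTop (𝓝 z.u) ∧
  Tendsto (fun k => (w k).v) atTop (𝓝 z.v) ∧
  Tendsto (fun k => (w k).gx) atTop (𝓝 z.gx) ∧
  Tendsto (fun k => (w k).gy) atTop (𝓝 z.gy) ∧
  Tendsto (fun k => (w k).gz) atTop (𝓝 z.gz)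

/-- The image `½(u + Pᵀ v)` returned by the method. -/
noncomputable def output {N : ℕ} (P : Matrix (Fin N) (Fin N) ℝ) (w : State N) : Fin N → ℝ :=
  (1 / 2 : ℝ) • (w.u + Pᵀ *ᵥ w.v)

theorem reorder_mulVec (n m : ℕ) (u : Fin (n * m) → ℝ) (p : Fin n × Fin m) :
    (reorder n m *ᵥ u) (rowMajor n m p) = u (colMajor n m p) := by
  simp [reorder, Matrix.permMatrix_mulVec]

theorem diffMatrix_mulVec (N : ℕ) (S : Finset (Fin N)) (x : Fin N → ℝ) (k : Fin N) :
    (diffMatrix N S *ᵥ x) k =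
      if k ∈ S then 0 else x k - (if h : k.val + 1 < N then x ⟨k.val + 1, h⟩ else 0) := by
  by_cases hk : k ∈ S
  · simp [Matrix.mulVec, dotProduct, diffMatrix, hk]
  · simp only [Matrix.mulVec, dotProduct, diffMatrix, hk, Matrix.of_apply, if_false]
    have key : ∀ l : Fin N, (if l = k then (1 : ℝ) else if l.val = k.val + 1 then -1 else 0) * x l
        = (if l = k then x l else 0) - (if l.val = k.val + 1 then x l else 0) := by
      intro l
      by_cases h1 : l = k
      · subst h1; simp
      · by_cases h2 : l.val = k.val + 1 <;> simp [h1, h2]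
    simp only [key, Finset.sum_sub_distrib, Finset.sum_ite_eq', Finset.mem_univ, if_true]
    congr 1
    split_ifs with h
    · rw [Finset.sum_eq_single (⟨k.val + 1, h⟩ : Fin N)]
      · simp
      · intro l _ hl
        rw [if_neg]
        intro h'; exact hl (Fin.ext h')
      · simp
    · apply Finset.sum_eq_zero
      intro l _
      rw [if_neg]
      have := l.isLt
      omega

/-- With the Neumann choice of zero rows, `anisoTV` is the sum over the pixels of the absolute
vertical and horizontal forward differences, those that would leave the image being zero. -/
theorem anisoTV_neumann (n m : ℕ) (u : Fin (n * m) → ℝ) :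
    anisoTV (diffMatrix (n * m) (columnEnds n m)) (diffMatrix (n * m) (rowEnds n m))
      (reorder n m) u =
    ∑ p : Fin n × Fin m,
      ((if h : p.1.val + 1 < n then
          |u (colMajor n m (⟨p.1.val + 1, h⟩, p.2)) - u (colMajor n m p)| else 0) +
       (if h : p.2.val + 1 < m then
          |u (colMajor n m (p.1, ⟨p.2.val + 1, h⟩)) - u (colMajor n m p)| else 0)) := by
  rw [Finset.sum_add_distrib, anisoTV, l1Norm, l1Norm]
  congr 1
  · rw [← (colMajor n m).sum_comp]
    refine Finset.sum_congr rfl fun p _ => ?_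
    obtain ⟨i, j⟩ := p
    rw [diffMatrix_mulVec]
    simp only [columnEnds, Finset.mem_filter, Finset.mem_univ, true_and, Equiv.symm_apply_apply]
    by_cases h : i.val + 1 < n
    · have e : ((colMajor n m) (i, j)).val + 1 = ((colMajor n m) (⟨i.val + 1, h⟩, j)).val := by
        simp [colMajor, finProdFinEquiv]; omega
      have h3 : ((colMajor n m) (i, j)).val + 1 < n * m := by rw [e]; exact Fin.isLt _
      have e' : (⟨((colMajor n m) (i, j)).val + 1, h3⟩ : Fin (n * m)) =
        (colMajor n m) (⟨i.val + 1, h⟩, j) := Fin.ext e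
      rw [if_neg (by omega), dif_pos h3, dif_pos h, e', abs_sub_comm]
    · rw [if_pos (by omega), dif_neg h, abs_zero]
  · rw [← (rowMajor n m).sum_comp]
    refine Finset.sum_congr rfl fun p _ => ?_
    obtain ⟨i, j⟩ := p
    rw [diffMatrix_mulVec]
    simp only [rowEnds, Finset.mem_filter, Finset.mem_univ, true_and, Equiv.symm_apply_apply]
    by_cases h : j.val + 1 < m
    · have e : ((rowMajor n m) (i, j)).val + 1 = ((rowMajor n m) (i, ⟨j.val + 1, h⟩)).val := by
        simp [rowMajor, finProdFinEquiv]; omega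
      have h3 : ((rowMajor n m) (i, j)).val + 1 < n * m := by rw [e]; exact Fin.isLt _
      have e' : (⟨((rowMajor n m) (i, j)).val + 1, h3⟩ : Fin (n * m)) =
        (rowMajor n m) (i, ⟨j.val + 1, h⟩) := Fin.ext e
      rw [if_neg (by omega), dif_pos h3, dif_pos h, e', reorder_mulVec, reorder_mulVec,
        abs_sub_comm]
    · rw [if_pos (by omega), dif_neg h, abs_zero]

end TVDenoise

namespace TVDenoise

/-! ### The linear systems -/

theorem diffMatrix_apply_eq_zero {N : ℕ} (S : Finset (Fin N)) {j k : Fin N}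
    (h₁ : k ≠ j) (h₂ : k.val ≠ j.val + 1) : diffMatrix N S j k = 0 := by
  simp [diffMatrix, h₁, h₂]

theorem isTridiagonal_gram_add_smul (N : ℕ) (S : Finset (Fin N)) (c : ℝ) :
    IsTridiagonal ((diffMatrix N S)ᵀ * diffMatrix N S + c • (1 : Matrix (Fin N) (Fin N) ℝ)) := by
  intro k l hkl
  have hne : k ≠ l := by rintro rfl; omega
  rw [Matrix.add_apply, Matrix.smul_apply, Matrix.one_apply_ne hne, smul_zero, add_zero,
    Matrix.mul_apply]
  refine Finset.sum_eq_zero fun j _ => ?_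
  rw [Matrix.transpose_apply]
  by_cases hk : k = j ∨ k.val = j.val + 1
  · rw [diffMatrix_apply_eq_zero S (j := j) (k := l), mul_zero]
    · rintro rfl
      rcases hk with rfl | hk <;> omega
    · rcases hk with rfl | hk <;> omega
  · push Not at hk
    rw [diffMatrix_apply_eq_zero S hk.1 hk.2, zero_mul]

theorem posDef_gram_add_smul {N : ℕ} (D : Matrix (Fin N) (Fin N) ℝ) {c : ℝ} (hc : 0 < c) :
    (Dᵀ * D + c • (1 : Matrix (Fin N) (Fin N) ℝ)).PosDef := by
  have h : (Dᵀ * D).PosSemidef := by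
    simpa [Matrix.conjTranspose_eq_transpose_of_trivial] using
      Matrix.posSemidef_conjTranspose_mul_self D
  exact Matrix.PosDef.posSemidef_add h (Matrix.PosDef.one.smul hc)

theorem existsUnique_mulVec_eq {N : ℕ} {M : Matrix (Fin N) (Fin N) ℝ} (hM : M.PosDef)
    (c : Fin N → ℝ) : ∃ x, M *ᵥ x = c ∧ ∀ y, M *ᵥ y = c → y = x := by
  have hu : IsUnit M.det := (Matrix.isUnit_iff_isUnit_det M).1 hM.isUnit
  refine ⟨M⁻¹ *ᵥ c, ?_, fun y hy => ?_⟩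
  · rw [Matrix.mulVec_mulVec, Matrix.mul_nonsing_inv _ hu, Matrix.one_mulVec]
  · rw [← hy, Matrix.mulVec_mulVec, Matrix.nonsing_inv_mul _ hu, Matrix.one_mulVec]

theorem reorder_transpose_mul (n m : ℕ) : (reorder n m)ᵀ * reorder n m = 1 := by
  rw [reorder, Matrix.transpose_permMatrix, ← Matrix.permMatrix_mul]
  simp

theorem transpose_mulVec_dotProduct {N : ℕ} (M : Matrix (Fin N) (Fin N) ℝ) (x y : Fin N → ℝ) :
    (Mᵀ *ᵥ x) ⬝ᵥ y = x ⬝ᵥ (M *ᵥ y) := by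
  rw [Matrix.mulVec_transpose, Matrix.dotProduct_mulVec]

theorem existsUnique_isADALStep {N : ℕ} (lam : ℝ) {μ₁ μ₂ : ℝ} (hμ₁ : 0 < μ₁) (hμ₂ : 0 < μ₂)
    (b : Fin N → ℝ) (Dx Dy P : Matrix (Fin N) (Fin N) ℝ) (w : State N) :
    ∃ w', IsADALStep lam μ₁ μ₂ b Dx Dy P w w' ∧
      ∀ w'', IsADALStep lam μ₁ μ₂ b Dx Dy P w w'' → w'' = w' := by
  obtain ⟨v, hv, hv'⟩ := existsUnique_mulVec_eq
    (posDef_gram_add_smul Dy (div_pos hμ₁ hμ₂))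
    (Dyᵀ *ᵥ (w.dy - μ₁ • w.gy) + μ₁ • w.gz + (μ₁ / μ₂) • (P *ᵥ w.u))
  obtain ⟨u, hu, hu'⟩ := existsUnique_mulVec_eq
    (posDef_gram_add_smul Dx (add_pos (div_pos hμ₁ hμ₂) hμ₁))
    (μ₁ • b + Dxᵀ *ᵥ (softThreshold (Dx *ᵥ w.u + μ₁ • w.gx) (lam * μ₁) - μ₁ • w.gx) +
      Pᵀ *ᵥ ((μ₁ / μ₂) • v - μ₁ • w.gz))
  refine ⟨⟨softThreshold (Dx *ᵥ w.u + μ₁ • w.gx) (lam * μ₁),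
    softThreshold (Dy *ᵥ v + μ₁ • w.gy) (lam * μ₁), u, v,
    w.gx + (1 / μ₁) • (Dx *ᵥ u - softThreshold (Dx *ᵥ w.u + μ₁ • w.gx) (lam * μ₁)),
    w.gy + (1 / μ₁) • (Dy *ᵥ v - softThreshold (Dy *ᵥ v + μ₁ • w.gy) (lam * μ₁)),
    w.gz + (1 / μ₂) • (P *ᵥ u - v)⟩,
    ⟨rfl, hv, rfl, hu, rfl, rfl, rfl⟩, fun w'' h => ?_⟩
  have ev : w''.v = v := hv' _ h.v_eq
  have eu : w''.u = u := hu' _ (by rw [← ev, ← h.dx_eq]; exact h.u_eq)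
  ext1
  · exact h.dx_eq
  · rw [h.dy_eq, ev]
  · exact eu
  · exact ev
  · rw [h.gx_eq, h.dx_eq, eu]
  · rw [h.gy_eq, h.dy_eq, ev]
  · rw [h.gz_eq, eu, ev]

theorem existsUnique_isADALRun {N : ℕ} (lam : ℝ) {μ₁ μ₂ : ℝ} (hμ₁ : 0 < μ₁) (hμ₂ : 0 < μ₂)
    (b : Fin N → ℝ) (Dx Dy P : Matrix (Fin N) (Fin N) ℝ) (w₀ : State N) :
    ∃! w : ℕ → State N, w 0 = w₀ ∧ IsADALRun lam μ₁ μ₂ b Dx Dy P w := by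
  choose f hf hf' using existsUnique_isADALStep lam hμ₁ hμ₂ b Dx Dy P
  refine ⟨fun k => f^[k] w₀, ⟨rfl, fun k => ?_⟩, fun w hw => ?_⟩
  · simp only [Function.iterate_succ_apply']
    exact hf _
  · funext k
    induction k with
    | zero => exact hw.1
    | succ k ih => rw [Function.iterate_succ_apply', ← ih]; exact hf' _ _ (hw.2 k)

/-! ### Subgradients of the `ℓ¹` norm -/

theorem softThreshold_scalar {x τ : ℝ} (hτ : 0 ≤ τ) (t : ℝ) :
    τ * |max (|x| - τ) 0 * Real.sign x| +
      (x - max (|x| - τ) 0 * Real.sign x) * (t - max (|x| - τ) 0 * Real.sign x) ≤ τ * |t| := by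
  have ht₁ := mul_le_mul_of_nonneg_left (le_abs_self t) hτ
  have ht₂ := mul_le_mul_of_nonneg_left (neg_le_abs t) hτ
  rcases le_total (|x|) τ with h | h
  · rw [max_eq_right (by linarith)]
    have : x * t ≤ τ * |t| := by
      calc x * t ≤ |x * t| := le_abs_self _
        _ = |x| * |t| := abs_mul _ _
        _ ≤ τ * |t| := mul_le_mul_of_nonneg_right h (abs_nonneg _)
    simpa using this
  · rw [max_eq_left (by linarith)]
    rcases lt_trichotomy x 0 with hx | rfl | hx
    · rw [abs_of_neg hx] at h ⊢
      rw [Real.sign_of_neg hx, abs_of_nonpos (by linarith)]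
      linarith
    · have : τ = 0 := le_antisymm (by simpa using h) hτ
      simp [this]
    · rw [abs_of_pos hx] at h ⊢
      rw [Real.sign_of_pos hx, abs_of_nonneg (by linarith)]
      linarith

theorem isSubgradient_softThreshold {N : ℕ} {lam μ : ℝ} (hlam : 0 ≤ lam) (hμ : 0 < μ)
    {x d : Fin N → ℝ} (hd : d = softThreshold x (lam * μ)) :
    IsSubgradient (fun d => lam * l1Norm d) d ((1 / μ) • (x - d)) := by
  subst hd
  intro y
  simp only [l1Norm, dotProduct, Finset.mul_sum]
  rw [← Finset.sum_add_distrib]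
  refine Finset.sum_le_sum fun k _ => ?_
  have h := softThreshold_scalar (x := x k) (mul_nonneg hlam hμ.le) (y k)
  have h' := mul_le_mul_of_nonneg_left h (one_div_pos.2 hμ).le
  simp only [softThreshold, Pi.smul_apply, Pi.sub_apply, smul_eq_mul]
  calc _ = 1 / μ * (lam * μ * |max (|x k| - lam * μ) 0 * (x k).sign| +
      (x k - max (|x k| - lam * μ) 0 * (x k).sign) *
        (y k - max (|x k| - lam * μ) 0 * (x k).sign)) := by field_simp
    _ ≤ _ := h'
    _ = _ := by field_simp

theorem IsSubgradient.monotone {N : ℕ} {F : (Fin N → ℝ) → ℝ} {x y g h : Fin N → ℝ}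
    (hx : IsSubgradient F x g) (hy : IsSubgradient F y h) : 0 ≤ (g - h) ⬝ᵥ (x - y) := by
  have h₁ := hx y
  have h₂ := hy x
  simp only [sub_dotProduct, dotProduct_sub] at *
  linarith

theorem isSubgradient_l1Norm_of_forall_box {N : ℕ} {lam : ℝ} (hlam : 0 ≤ lam)
    {x p : Fin N → ℝ} (hp : ∀ k, |p k| ≤ lam)
    (h : ∀ q : Fin N → ℝ, (∀ k, |q k| ≤ lam) → q ⬝ᵥ x ≤ p ⬝ᵥ x) :
    IsSubgradient (fun d => lam * l1Norm d) x p := by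
  intro y
  have h₁ : lam * l1Norm x ≤ p ⬝ᵥ x := by
    refine le_of_eq_of_le ?_ (h (fun k => lam * SignType.sign (x k)) fun k => ?_)
    · simp only [l1Norm, dotProduct, Finset.mul_sum]
      refine Finset.sum_congr rfl fun k _ => ?_
      rw [mul_assoc, sign_mul_self]
    · rw [abs_mul, abs_of_nonneg hlam]
      refine mul_le_of_le_one_right hlam ?_
      rcases lt_trichotomy (x k) 0 with hx | hx | hx <;> simp [hx]
  have h₂ : p ⬝ᵥ y ≤ lam * l1Norm y := by
    simp only [l1Norm, dotProduct, Finset.mul_sum]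
    refine Finset.sum_le_sum fun k _ => ?_
    calc p k * y k ≤ |p k * y k| := le_abs_self _
      _ = |p k| * |y k| := abs_mul _ _
      _ ≤ lam * |y k| := mul_le_mul_of_nonneg_right (hp k) (abs_nonneg _)
  simp only [dotProduct_sub]
  linarith

theorem sqNorm_eq_dotProduct {N : ℕ} (x : Fin N → ℝ) : sqNorm x = x ⬝ᵥ x := by
  simp only [sqNorm, dotProduct, sq]

theorem sqNorm_nonneg {N : ℕ} (x : Fin N → ℝ) : 0 ≤ sqNorm x :=
  Finset.sum_nonneg fun _ _ => sq_nonneg _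

theorem sqNorm_pos {N : ℕ} {x : Fin N → ℝ} (hx : x ≠ 0) : 0 < sqNorm x := by
  obtain ⟨k, hk⟩ := Function.ne_iff.1 hx
  exact Finset.sum_pos' (fun _ _ => sq_nonneg _) ⟨k, Finset.mem_univ _, sq_pos_of_ne_zero hk⟩

theorem sqNorm_add {N : ℕ} (x y : Fin N → ℝ) :
    sqNorm (x + y) = sqNorm x + 2 * x ⬝ᵥ y + sqNorm y := by
  simp only [sqNorm_eq_dotProduct, add_dotProduct, dotProduct_add, dotProduct_comm y x]
  ring

theorem norm_sq_le_sqNorm {N : ℕ} (x : Fin N → ℝ) : ‖x‖ ^ 2 ≤ sqNorm x := by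
  have : ‖x‖ ≤ √(sqNorm x) := by
    refine (pi_norm_le_iff_of_nonneg (Real.sqrt_nonneg _)).2 fun k => ?_
    refine Real.abs_le_sqrt ?_
    exact Finset.single_le_sum (f := fun k => x k ^ 2) (fun _ _ => sq_nonneg _)
      (Finset.mem_univ k)
  calc ‖x‖ ^ 2 ≤ √(sqNorm x) ^ 2 := by gcongr
    _ = sqNorm x := Real.sq_sqrt (sqNorm_nonneg x)

@[fun_prop]
theorem continuous_l1Norm {N : ℕ} : Continuous (l1Norm (N := N)) := by
  unfold l1Norm; fun_prop

@[fun_prop]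
theorem continuous_sqNorm {N : ℕ} : Continuous (sqNorm (N := N)) := by
  unfold sqNorm; fun_prop

theorem isClosed_isSubgradient {N : ℕ} {F : (Fin N → ℝ) → ℝ} (hF : Continuous F) {X : Type*}
    [TopologicalSpace X] {f g : X → Fin N → ℝ} (hf : Continuous f) (hg : Continuous g) :
    IsClosed {p | IsSubgradient F (f p) (g p)} := by
  simp only [IsSubgradient, Set.ofPred_forall]
  refine isClosed_iInter fun y => isClosed_le ?_ continuous_const
  exact (hF.comp hf).add (hg.dotProduct (continuous_const.sub hf))

/-! ### Kuhn–Tucker points -/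

section KuhnTucker

variable {N : ℕ} {lam μ₁ μ₂ : ℝ} {b : Fin N → ℝ} {Dx Dy P : Matrix (Fin N) (Fin N) ℝ}

theorem nonpos_of_forall_small {a c : ℝ} (hc : 0 ≤ c)
    (h : ∀ t : ℝ, 0 < t → t ≤ 1 → 2 * t * a ≤ t ^ 2 * c) : a ≤ 0 := by
  by_contra! ha
  have ht : 0 < min 1 (a / (c + 1)) := lt_min one_pos (by positivity)
  have h₁ := h _ ht (min_le_left _ _)
  have h₂ : min 1 (a / (c + 1)) * (c + 1) ≤ a :=
    (le_div_iff₀ (by linarith)).1 (min_le_right _ _)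
  have h₃ : 2 * a ≤ min 1 (a / (c + 1)) * c := by
    refine le_of_mul_le_mul_left ?_ ht
    linarith
  linarith

theorem isSubgradient_half_sqNorm_sub (b u : Fin N → ℝ) :
    IsSubgradient (fun u => 1 / 2 * sqNorm (u - b)) u (u - b) := by
  intro y
  have h := sqNorm_add (u - b) (y - u)
  have h' := sqNorm_nonneg (y - u)
  rw [sub_add_sub_comm, add_comm u y, add_sub_add_comm, sub_self, add_zero] at h
  simp only
  linarith

/-- A maximizer of the dual problem (the projection of `b` onto the image of a box) yields a
Kuhn–Tucker point. -/
theorem exists_isKuhnTucker (hlam : 0 ≤ lam) :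
    ∃ z : State N, IsKuhnTucker lam b Dx Dy P z ∧
      z.u - b + (Dxᵀ *ᵥ z.gx + Pᵀ *ᵥ z.gz) = 0 := by
  have hmem : ∀ z : (Fin N → ℝ) × (Fin N → ℝ), z ∈ Metric.closedBall 0 lam ↔
      (∀ k, |z.1 k| ≤ lam) ∧ ∀ k, |z.2 k| ≤ lam := fun z => by
    rw [mem_closedBall_zero_iff, norm_prod_le_iff, pi_norm_le_iff_of_nonneg hlam,
      pi_norm_le_iff_of_nonneg hlam]
    rfl
  obtain ⟨⟨p, q⟩, hpq, hmin⟩ :=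
    (isCompact_closedBall (0 : (Fin N → ℝ) × (Fin N → ℝ)) lam).exists_isMinOn
    ⟨0, Metric.mem_closedBall_self hlam⟩
    (f := fun z => sqNorm (b - (Dxᵀ *ᵥ z.1 + Pᵀ *ᵥ (Dyᵀ *ᵥ z.2))))
    (Continuous.continuousOn (by fun_prop))
  set u := b - (Dxᵀ *ᵥ p + Pᵀ *ᵥ (Dyᵀ *ᵥ q)) with hu
  have hvar : ∀ p' q', (∀ k, |p' k| ≤ lam) → (∀ k, |q' k| ≤ lam) →
      (p' - p) ⬝ᵥ (Dx *ᵥ u) + (q' - q) ⬝ᵥ (Dy *ᵥ (P *ᵥ u)) ≤ 0 := by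
    intro p' q' hp' hq'
    set e := Dxᵀ *ᵥ (p' - p) + Pᵀ *ᵥ (Dyᵀ *ᵥ (q' - q)) with he
    have he' : (p' - p) ⬝ᵥ (Dx *ᵥ u) + (q' - q) ⬝ᵥ (Dy *ᵥ (P *ᵥ u)) = e ⬝ᵥ u := by
      simp only [he, add_dotProduct, transpose_mulVec_dotProduct]
    rw [he']
    refine nonpos_of_forall_small (sqNorm_nonneg e) fun t ht ht1 => ?_
    have hmem' := (convex_closedBall (0 : (Fin N → ℝ) × (Fin N → ℝ)) lam).add_smul_sub_mem hpq
      ((hmem (p', q')).2 ⟨hp', hq'⟩) ⟨ht.le, ht1⟩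
    have h := hmin hmem'
    have hu' : b - (Dxᵀ *ᵥ (p + t • (p' - p)) + Pᵀ *ᵥ (Dyᵀ *ᵥ (q + t • (q' - q))))
        = u + (-t) • e := by
      simp only [hu, he, Matrix.mulVec_add, Matrix.mulVec_smul]
      module
    simp only [Set.mem_ofPred_eq, Prod.fst_add, Prod.snd_add, Prod.smul_fst, Prod.smul_snd,
      Prod.fst_sub, Prod.snd_sub] at h
    rw [hu', sqNorm_add] at h
    simp only [sqNorm_eq_dotProduct, dotProduct_smul, smul_dotProduct, smul_eq_mul,
      dotProduct_comm u e] at h ⊢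
    linarith
  obtain ⟨hp, hq⟩ := (hmem _).1 hpq
  have hgrad : -(Dxᵀ *ᵥ p + Pᵀ *ᵥ (Dyᵀ *ᵥ q)) = u - b := by rw [hu]; abel
  refine ⟨⟨Dx *ᵥ u, Dy *ᵥ (P *ᵥ u), u, P *ᵥ u, p, q, Dyᵀ *ᵥ q⟩,
    ⟨⟨rfl, rfl, rfl⟩, ?_, ?_, ?_, sub_self _⟩, ?_⟩
  · refine isSubgradient_l1Norm_of_forall_box hlam hp fun p' hp' => ?_
    simpa [sub_dotProduct] using hvar p' q hp' hq
  · refine isSubgradient_l1Norm_of_forall_box hlam hq fun q' hq' => ?_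
    simpa [sub_dotProduct] using hvar p q' hp hq'
  · rw [hgrad]
    exact isSubgradient_half_sqNorm_sub b u
  · rw [← hgrad]
    exact neg_add_cancel _

theorem IsKuhnTucker.splitObjective_le {z : State N} (hz : IsKuhnTucker lam b Dx Dy P z)
    {z' : State N} (hz' : IsFeasible Dx Dy P z')
    {c : ℝ} (hc : 1 / 2 * sqNorm (z.u - b) + -(Dxᵀ *ᵥ z.gx + Pᵀ *ᵥ z.gz) ⬝ᵥ (z'.u - z.u) + c ≤
      1 / 2 * sqNorm (z'.u - b)) :
    splitObjective lam b z + c ≤ splitObjective lam b z' := by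
  obtain ⟨⟨h₁, h₂, h₃⟩, hx, hy, -, hv⟩ := hz
  obtain ⟨h₁', h₂', h₃'⟩ := hz'
  have hx' := hx z'.dx
  have hy' := hy z'.dy
  have hgz : z.gz = Dyᵀ *ᵥ z.gy := (sub_eq_zero.1 hv).symm
  rw [h₁, h₁', ← Matrix.mulVec_sub] at hx'
  rw [h₂, h₂', h₃, h₃', ← Matrix.mulVec_sub, ← Matrix.mulVec_sub] at hy'
  rw [hgz, neg_dotProduct, add_dotProduct] at hc
  simp only [transpose_mulVec_dotProduct] at hc
  simp only [splitObjective, h₁, h₁', h₂, h₂', h₃, h₃']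
  simp only at hx' hy'
  linarith

theorem IsKuhnTucker.isSplitSolution {z : State N} (hz : IsKuhnTucker lam b Dx Dy P z) :
    IsSplitSolution lam b Dx Dy P z := by
  refine ⟨hz.1, fun z' hz' => ?_⟩
  have h := hz.splitObjective_le hz' (c := 0) (by simpa using hz.2.2.2.1 z'.u)
  simpa using h

theorem IsKuhnTucker.tvObjective_lt {z : State N} (hz : IsKuhnTucker lam b Dx Dy P z)
    (hgrad : z.u - b + (Dxᵀ *ᵥ z.gx + Pᵀ *ᵥ z.gz) = 0) {u : Fin N → ℝ} (hu : u ≠ z.u) :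
    tvObjective lam b Dx Dy P z.u < tvObjective lam b Dx Dy P u := by
  have hg : -(Dxᵀ *ᵥ z.gx + Pᵀ *ᵥ z.gz) = z.u - b := (eq_neg_of_add_eq_zero_left hgrad).symm
  have h := hz.splitObjective_le
    (z' := ⟨Dx *ᵥ u, Dy *ᵥ (P *ᵥ u), u, P *ᵥ u, 0, 0, 0⟩) ⟨rfl, rfl, rfl⟩
    (c := 1 / 2 * sqNorm (u - z.u)) (by
      have h := sqNorm_add (z.u - b) (u - z.u)
      rw [sub_add_sub_comm, add_comm z.u u, add_sub_add_comm, sub_self, add_zero] at h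
      rw [hg, h]
      simp only
      linarith)
  have hpos := sqNorm_pos (sub_ne_zero.2 hu)
  obtain ⟨h₁, h₂, h₃⟩ := hz.1
  simp only [splitObjective, h₁, h₂, h₃] at h
  simp only [tvObjective, anisoTV]
  linarith

end KuhnTucker

/-! ### Energy estimate -/

section Energy

variable {N : ℕ} {lam μ₁ μ₂ : ℝ} {b : Fin N → ℝ} {Dx Dy P : Matrix (Fin N) (Fin N) ℝ}

/-- The variables `(u, dy, gx, gy, gz)` which one iteration passes on to the next. -/
abbrev Carried (N : ℕ) : Type :=
  (Fin N → ℝ) × (Fin N → ℝ) × (Fin N → ℝ) × (Fin N → ℝ) × (Fin N → ℝ)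

/-- The carried variables of a state. -/
def State.carried (w : State N) : Carried N := (w.u, w.dy, w.gx, w.gy, w.gz)

/-- The squared norm on the carried variables in which the iteration is Fejér monotone. -/
noncomputable def energy (μ₁ μ₂ : ℝ) (Dx P : Matrix (Fin N) (Fin N) ℝ) (x : Carried N) : ℝ :=
  μ₁ * sqNorm x.2.2.1 + μ₁ * sqNorm x.2.2.2.1 + μ₂ * sqNorm x.2.2.2.2 +
    (1 / μ₁ * (sqNorm (Dx *ᵥ x.1) + sqNorm x.2.1) + 1 / μ₂ * sqNorm (P *ᵥ x.1))

/-- The value of `dx` after an iteration leading from `x` to `y`. -/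
def nextDx (μ₁ : ℝ) (Dx : Matrix (Fin N) (Fin N) ℝ) (x y : Carried N) : Fin N → ℝ :=
  Dx *ᵥ y.1 - μ₁ • (y.2.2.1 - x.2.2.1)

/-- The value of `v` after an iteration leading from `x` to `y`. -/
def nextV (μ₂ : ℝ) (P : Matrix (Fin N) (Fin N) ℝ) (x y : Carried N) : Fin N → ℝ :=
  P *ᵥ y.1 - μ₂ • (y.2.2.2.2 - x.2.2.2.2)

/-- Optimality conditions of the two minimization blocks `(dx, v)` and `(dy, u)` and the update of
the multiplier of `dy = Dy v`, for an iteration leading from `x` to `y`. -/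
structure IsOptimalStep (lam μ₁ μ₂ : ℝ) (b : Fin N → ℝ) (Dx Dy P : Matrix (Fin N) (Fin N) ℝ)
    (x y : Carried N) : Prop where
  dx : IsSubgradient (fun d => lam * l1Norm d) (nextDx μ₁ Dx x y)
    (y.2.2.1 - (1 / μ₁) • (Dx *ᵥ (y.1 - x.1)))
  v : Dyᵀ *ᵥ (y.2.2.2.1 + (1 / μ₁) • (y.2.1 - x.2.1)) =
    y.2.2.2.2 - (1 / μ₂) • (P *ᵥ (y.1 - x.1))
  dy : IsSubgradient (fun d => lam * l1Norm d) y.2.1 y.2.2.2.1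
  u : y.1 - b + (Dxᵀ *ᵥ y.2.2.1 + Pᵀ *ᵥ y.2.2.2.2) = 0
  gy : y.2.1 = Dy *ᵥ nextV μ₂ P x y - μ₁ • (y.2.2.2.1 - x.2.2.2.1)

theorem isClosed_isOptimalStep :
    IsClosed {p : Carried N × Carried N | IsOptimalStep lam μ₁ μ₂ b Dx Dy P p.1 p.2} := by
  have hF : Continuous fun d : Fin N → ℝ => lam * l1Norm d := by fun_prop
  have : {p : Carried N × Carried N | IsOptimalStep lam μ₁ μ₂ b Dx Dy P p.1 p.2} =
      {p | IsSubgradient (fun d => lam * l1Norm d) (nextDx μ₁ Dx p.1 p.2)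
        (p.2.2.2.1 - (1 / μ₁) • (Dx *ᵥ (p.2.1 - p.1.1)))} ∩
      {p | Dyᵀ *ᵥ (p.2.2.2.2.1 + (1 / μ₁) • (p.2.2.1 - p.1.2.1)) =
        p.2.2.2.2.2 - (1 / μ₂) • (P *ᵥ (p.2.1 - p.1.1))} ∩
      {p | IsSubgradient (fun d => lam * l1Norm d) p.2.2.1 p.2.2.2.2.1} ∩
      {p | p.2.1 - b + (Dxᵀ *ᵥ p.2.2.2.1 + Pᵀ *ᵥ p.2.2.2.2.2) = 0} ∩
      {p | p.2.2.1 = Dy *ᵥ nextV μ₂ P p.1 p.2 - μ₁ • (p.2.2.2.2.1 - p.1.2.2.2.1)} := by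
    ext p
    exact ⟨fun h => ⟨⟨⟨⟨h.dx, h.v⟩, h.dy⟩, h.u⟩, h.gy⟩,
      fun ⟨⟨⟨⟨h₁, h₂⟩, h₃⟩, h₄⟩, h₅⟩ => ⟨h₁, h₂, h₃, h₄, h₅⟩⟩
  rw [this]
  unfold nextDx nextV
  refine ((((isClosed_isSubgradient hF ?_ ?_).inter (isClosed_eq ?_ ?_)).inter
    (isClosed_isSubgradient hF ?_ ?_)).inter (isClosed_eq ?_ ?_)).inter (isClosed_eq ?_ ?_)
  all_goals fun_prop

theorem IsADALStep.isOptimalStep (hlam : 0 ≤ lam) (hμ₁ : 0 < μ₁) (hμ₂ : 0 < μ₂)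
    {w w' : State N} (hP : Pᵀ * P = 1) (h : IsADALStep lam μ₁ μ₂ b Dx Dy P w w') :
    IsOptimalStep lam μ₁ μ₂ b Dx Dy P w.carried w'.carried ∧
      w'.dx = nextDx μ₁ Dx w.carried w'.carried ∧ w'.v = nextV μ₂ P w.carried w'.carried := by
  have hinv : ∀ {μ : ℝ}, 0 < μ → ∀ x : Fin N → ℝ, μ • (1 / μ) • x = x := fun hμ x => by
    rw [smul_smul, mul_one_div_cancel hμ.ne', one_smul]
  have hgx : μ₁ • (w'.gx - w.gx) = Dx *ᵥ w'.u - w'.dx := by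
    rw [h.gx_eq, add_sub_cancel_left, hinv hμ₁]
  have hgy : μ₁ • (w'.gy - w.gy) = Dy *ᵥ w'.v - w'.dy := by
    rw [h.gy_eq, add_sub_cancel_left, hinv hμ₁]
  have hgz : μ₂ • (w'.gz - w.gz) = P *ᵥ w'.u - w'.v := by
    rw [h.gz_eq, add_sub_cancel_left, hinv hμ₂]
  have hdx : w'.dx = nextDx μ₁ Dx w.carried w'.carried := by
    simp only [nextDx, State.carried, hgx, sub_sub_cancel]
  have hv : w'.v = nextV μ₂ P w.carried w'.carried := by
    simp only [nextV, State.carried, hgz, sub_sub_cancel]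
  refine ⟨⟨?_, ?_, ?_, ?_, ?_⟩, hdx, hv⟩
  · rw [← hdx]
    convert isSubgradient_softThreshold hlam hμ₁ h.dx_eq using 1
    simp only [State.carried, h.gx_eq, Matrix.mulVec_sub]
    ext k
    simp only [Pi.add_apply, Pi.sub_apply, Pi.smul_apply, smul_eq_mul]
    field_simp
    ring
  · have e := h.v_eq
    rw [vMatrix, Matrix.add_mulVec, Matrix.smul_mulVec, Matrix.one_mulVec,
      ← Matrix.mulVec_mulVec] at e
    simp only [State.carried, h.gy_eq, h.gz_eq, Matrix.mulVec_sub, Matrix.mulVec_add,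
      Matrix.mulVec_smul] at e ⊢
    ext k
    have ek := congrFun e k
    simp only [Pi.add_apply, Pi.sub_apply, Pi.smul_apply, smul_eq_mul] at ek ⊢
    field_simp at ek ⊢
    linarith
  · change IsSubgradient _ w'.dy w'.gy
    convert isSubgradient_softThreshold hlam hμ₁ h.dy_eq using 1
    rw [h.gy_eq]
    ext k
    simp only [Pi.add_apply, Pi.sub_apply, Pi.smul_apply, smul_eq_mul]
    field_simp
    ring
  · have e := h.u_eq
    rw [uMatrix, Matrix.add_mulVec, Matrix.smul_mulVec, Matrix.one_mulVec,
      ← Matrix.mulVec_mulVec] at e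
    have hPu : Pᵀ *ᵥ (P *ᵥ w'.u) = w'.u := by
      rw [Matrix.mulVec_mulVec, hP, Matrix.one_mulVec]
    simp only [State.carried, h.gx_eq, h.gz_eq, Matrix.mulVec_sub, Matrix.mulVec_add,
      Matrix.mulVec_smul, hPu] at e ⊢
    ext k
    have ek := congrFun e k
    simp only [Pi.add_apply, Pi.sub_apply, Pi.smul_apply, smul_eq_mul, Pi.zero_apply] at ek ⊢
    field_simp at ek ⊢
    linarith
  · rw [← hv]
    simp only [State.carried, hgy, sub_sub_cancel]

/-- The algebra behind the energy estimate: capital letters stand for differences of the new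
iterate and a solution, small letters for differences of consecutive iterates. -/
theorem energy_identity (hμ₁ : μ₁ ≠ 0) (hμ₂ : μ₂ ≠ 0)
    (A C Y X₁ X₂ X₃ a c y x₁ x₂ x₃ : Fin N → ℝ) :
    (μ₁ * sqNorm (X₁ - x₁) + μ₁ * sqNorm (X₂ - x₂) + μ₂ * sqNorm (X₃ - x₃) +
        (1 / μ₁ * (sqNorm (A - a) + sqNorm (Y - y)) + 1 / μ₂ * sqNorm (C - c))) -
      (μ₁ * sqNorm X₁ + μ₁ * sqNorm X₂ + μ₂ * sqNorm X₃ +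
        (1 / μ₁ * (sqNorm A + sqNorm Y) + 1 / μ₂ * sqNorm C)) -
      (μ₁ * sqNorm x₁ + μ₁ * sqNorm x₂ + μ₂ * sqNorm x₃ +
        (1 / μ₁ * (sqNorm a + sqNorm y) + 1 / μ₂ * sqNorm c)) =
    2 * ((X₁ - (1 / μ₁) • a) ⬝ᵥ (A - μ₁ • x₁) + X₂ ⬝ᵥ Y -
      ((X₂ + (1 / μ₁) • y) ⬝ᵥ (Y + μ₁ • x₂) - (X₃ - (1 / μ₂) • c) ⬝ᵥ (C - μ₂ • x₃)) -
      (X₁ ⬝ᵥ A + X₃ ⬝ᵥ C) + x₂ ⬝ᵥ y - (x₁ ⬝ᵥ a + x₃ ⬝ᵥ c)) := by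
  simp only [sqNorm, dotProduct, Finset.mul_sum, ← Finset.sum_add_distrib,
    ← Finset.sum_sub_distrib]
  refine Finset.sum_congr rfl fun k _ => ?_
  simp only [Pi.add_apply, Pi.sub_apply, Pi.smul_apply, smul_eq_mul]
  field_simp
  ring

theorem IsOptimalStep.pairing_nonpos {x y x' y' : Carried N}
    (h : IsOptimalStep lam μ₁ μ₂ b Dx Dy P x y) (h' : IsOptimalStep lam μ₁ μ₂ b Dx Dy P x' y') :
    (y.2.2.1 - y'.2.2.1) ⬝ᵥ (Dx *ᵥ (y.1 - y'.1)) +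
      (y.2.2.2.2 - y'.2.2.2.2) ⬝ᵥ (P *ᵥ (y.1 - y'.1)) ≤ 0 := by
  have e : Dxᵀ *ᵥ (y.2.2.1 - y'.2.2.1) + Pᵀ *ᵥ (y.2.2.2.2 - y'.2.2.2.2) = -(y.1 - y'.1) := by
    rw [Matrix.mulVec_sub, Matrix.mulVec_sub]
    linear_combination (exp := 1) h.u - h'.u
  rw [← transpose_mulVec_dotProduct, ← transpose_mulVec_dotProduct, ← add_dotProduct, e,
    neg_dotProduct, ← sqNorm_eq_dotProduct]
  linarith [sqNorm_nonneg (y.1 - y'.1)]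

/-- Fejér monotonicity with respect to fixed points of the step. -/
theorem IsOptimalStep.energy_le (hμ₁ : 0 < μ₁) (hμ₂ : 0 < μ₂) {x y y' z : Carried N}
    (h : IsOptimalStep lam μ₁ μ₂ b Dx Dy P x y) (h' : IsOptimalStep lam μ₁ μ₂ b Dx Dy P y y')
    (hz : IsOptimalStep lam μ₁ μ₂ b Dx Dy P z z) :
    energy μ₁ μ₂ Dx P (y' - z) + energy μ₁ μ₂ Dx P (y' - y) ≤ energy μ₁ μ₂ Dx P (y - z) := by
  have key := energy_identity hμ₁.ne' hμ₂.ne' (Dx *ᵥ (y'.1 - z.1)) (P *ᵥ (y'.1 - z.1))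
    (y'.2.1 - z.2.1) (y'.2.2.1 - z.2.2.1) (y'.2.2.2.1 - z.2.2.2.1) (y'.2.2.2.2 - z.2.2.2.2)
    (Dx *ᵥ (y'.1 - y.1)) (P *ᵥ (y'.1 - y.1)) (y'.2.1 - y.2.1) (y'.2.2.1 - y.2.2.1)
    (y'.2.2.2.1 - y.2.2.2.1) (y'.2.2.2.2 - y.2.2.2.2)
  have h₁ := h'.dx.monotone hz.dx
  have h₂ := h'.dy.monotone hz.dy
  have h₃ := h'.dy.monotone h.dy
  have h₄ := h'.pairing_nonpos h
  have h₅ : (y'.2.2.1 - z.2.2.1) ⬝ᵥ (Dx *ᵥ (y'.1 - z.1)) +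
      (y'.2.2.2.2 - z.2.2.2.2) ⬝ᵥ (P *ᵥ (y'.1 - z.1)) ≤ 0 := h'.pairing_nonpos hz
  have hV : Dyᵀ *ᵥ ((y'.2.2.2.1 - z.2.2.2.1) + (1 / μ₁) • (y'.2.1 - y.2.1)) =
      (y'.2.2.2.2 - z.2.2.2.2) - (1 / μ₂) • (P *ᵥ (y'.1 - y.1)) := by
    have e := h'.v
    have e' := hz.v
    simp only [sub_self, smul_zero, add_zero, sub_zero, Matrix.mulVec_zero] at e'
    rw [add_comm, add_sub_assoc', add_comm, Matrix.mulVec_sub, e, e']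
    abel
  have hvv : Dy *ᵥ (P *ᵥ (y'.1 - z.1) - μ₂ • (y'.2.2.2.2 - y.2.2.2.2)) =
      (y'.2.1 - z.2.1) + μ₁ • (y'.2.2.2.1 - y.2.2.2.1) := by
    have e := h'.gy
    have e' := hz.gy
    simp only [nextV, sub_self, smul_zero, sub_zero] at e e'
    rw [e, e']
    simp only [Matrix.mulVec_sub]
    abel
  have h₆ := transpose_mulVec_dotProduct Dy
    ((y'.2.2.2.1 - z.2.2.2.1) + (1 / μ₁) • (y'.2.1 - y.2.1))
    (P *ᵥ (y'.1 - z.1) - μ₂ • (y'.2.2.2.2 - y.2.2.2.2))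
  rw [hV, hvv] at h₆
  have h₁' : 0 ≤ ((y'.2.2.1 - z.2.2.1) - (1 / μ₁) • (Dx *ᵥ (y'.1 - y.1))) ⬝ᵥ
      (Dx *ᵥ (y'.1 - z.1) - μ₁ • (y'.2.2.1 - y.2.2.1)) := by
    convert h₁ using 2
    · simp only [sub_self, Matrix.mulVec_zero, smul_zero, sub_zero]
      abel
    · simp only [nextDx, sub_self, smul_zero, sub_zero, Matrix.mulVec_sub]
      abel
  simp only [sub_sub_sub_cancel_left, ← Matrix.mulVec_sub] at key
  simp only [energy, Prod.fst_sub, Prod.snd_sub]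
  linarith

theorem energy_zero : energy μ₁ μ₂ Dx P 0 = 0 := by
  simp [energy, sqNorm]

theorem continuous_energy : Continuous (energy μ₁ μ₂ Dx P) := by
  unfold energy; fun_prop

theorem energy_nonneg (hμ₁ : 0 < μ₁) (hμ₂ : 0 < μ₂) (x : Carried N) :
    0 ≤ energy μ₁ μ₂ Dx P x := by
  have := sqNorm_nonneg (N := N)
  unfold energy
  have h : ∀ c : ℝ, 0 < c → ∀ x : Fin N → ℝ, 0 ≤ c * sqNorm x := fun c hc x =>
    mul_nonneg hc.le (this x)
  have := h _ hμ₁ x.2.2.1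
  have := h _ hμ₁ x.2.2.2.1
  have := h _ hμ₂ x.2.2.2.2
  have := h _ (one_div_pos.2 hμ₁) (Dx *ᵥ x.1)
  have := h _ (one_div_pos.2 hμ₁) x.2.1
  have := h _ (one_div_pos.2 hμ₂) (P *ᵥ x.1)
  linarith

theorem norm_sq_le_energy (hμ₁ : 0 < μ₁) (hμ₂ : 0 < μ₂) (hP : Pᵀ * P = 1) (x : Carried N) :
    ‖x‖ ^ 2 ≤ (μ₁ + μ₂ + 1 / μ₁ + 1 / μ₂) * energy μ₁ μ₂ Dx P x := by
  have hs := sqNorm_nonneg (N := N)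
  have hE := energy_nonneg (Dx := Dx) (P := P) hμ₁ hμ₂ x
  have hi₁ : 0 < 1 / μ₁ := one_div_pos.2 hμ₁
  have hi₂ : 0 < 1 / μ₂ := one_div_pos.2 hμ₂
  have hPu : sqNorm (P *ᵥ x.1) = sqNorm x.1 := by
    rw [sqNorm_eq_dotProduct, ← transpose_mulVec_dotProduct, Matrix.mulVec_mulVec, hP,
      Matrix.one_mulVec, sqNorm_eq_dotProduct]
  have h : ∀ c : ℝ, 0 < c → ∀ x : Fin N → ℝ, 0 ≤ c * sqNorm x := fun c hc x =>
    mul_nonneg hc.le (hs x)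
  have h₁ := h _ hμ₁ x.2.2.1
  have h₂ := h _ hμ₁ x.2.2.2.1
  have h₃ := h _ hμ₂ x.2.2.2.2
  have h₄ := h _ hi₁ (Dx *ᵥ x.1)
  have h₅ := h _ hi₁ x.2.1
  have h₆ := h _ hi₂ x.1
  set K := μ₁ + μ₂ + 1 / μ₁ + 1 / μ₂ with hK
  set E := energy μ₁ μ₂ Dx P x with hEdef
  have hbound : ∀ c d : ℝ, 0 < c → c * d = 1 → d ≤ K → ∀ y : Fin N → ℝ,
      c * sqNorm y ≤ E → ‖y‖ ≤ √(K * E) := by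
    intro c d hc hcd hd y hy
    refine Real.le_sqrt_of_sq_le ((norm_sq_le_sqNorm y).trans ?_)
    have hd' : 0 ≤ d := by
      by_contra! hneg
      linarith [mul_neg_of_pos_of_neg hc hneg]
    calc sqNorm y = d * (c * sqNorm y) := by rw [← mul_assoc, mul_comm d c, hcd, one_mul]
      _ ≤ d * E := mul_le_mul_of_nonneg_left hy hd'
      _ ≤ K * E := mul_le_mul_of_nonneg_right hd hE
  have hEeq : E = μ₁ * sqNorm x.2.2.1 + μ₁ * sqNorm x.2.2.2.1 + μ₂ * sqNorm x.2.2.2.2 +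
      (1 / μ₁ * (sqNorm (Dx *ᵥ x.1) + sqNorm x.2.1) + 1 / μ₂ * sqNorm x.1) := by
    rw [hEdef, energy, hPu]
  have hx : ‖x‖ ≤ √(K * E) := by
    simp only [norm_prod_le_iff]
    refine ⟨hbound (1 / μ₂) μ₂ hi₂ ?_ ?_ _ ?_, hbound (1 / μ₁) μ₁ hi₁ ?_ ?_ _ ?_,
      hbound μ₁ (1 / μ₁) hμ₁ ?_ ?_ _ ?_, hbound μ₁ (1 / μ₁) hμ₁ ?_ ?_ _ ?_,
      hbound μ₂ (1 / μ₂) hμ₂ ?_ ?_ _ ?_⟩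
    all_goals first | linarith | exact one_div_mul_cancel (ne_of_gt ‹_›) |
      exact mul_one_div_cancel (ne_of_gt ‹_›)
  calc ‖x‖ ^ 2 ≤ √(K * E) ^ 2 := by gcongr
    _ = K * E := Real.sq_sqrt (mul_nonneg (by linarith) hE)

end Energy

/-! ### Convergence -/

/-- A Fejér monotone sequence whose consecutive terms satisfy a closed relation converges to a
fixed point of the relation. -/
theorem exists_tendsto_of_fejer {X : Type*} [NormedAddCommGroup X] [ProperSpace X]
    {Q : X → ℝ} (hQ : Continuous Q) (hQ0 : Q 0 = 0) {K : ℝ} (hK : 0 ≤ K)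
    (hQK : ∀ x, ‖x‖ ^ 2 ≤ K * Q x) (hQnn : ∀ x, 0 ≤ Q x) {R : X → X → Prop}
    (hR : IsClosed {p : X × X | R p.1 p.2}) {x : ℕ → X} (hx : ∀ k, R (x k) (x (k + 1)))
    (hfix : ∃ z, R z z)
    (hfejer : ∀ z, R z z → ∀ k, Q (x (k + 1) - z) + Q (x (k + 1) - x k) ≤ Q (x k - z)) :
    ∃ z, R z z ∧ Tendsto x atTop (𝓝 z) := by
  have hanti : ∀ z, R z z → Antitone fun k => Q (x k - z) := fun z hz =>
    antitone_nat_of_succ_le fun k => by linarith [hfejer z hz k, hQnn (x (k + 1) - x k)]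
  have hconv : ∀ y : ℕ → X, Tendsto (fun k => Q (y k)) atTop (𝓝 0) →
      Tendsto y atTop (𝓝 0) := fun y hy => by
    rw [tendsto_zero_iff_norm_tendsto_zero]
    have h : Tendsto (fun k => √(K * Q (y k))) atTop (𝓝 0) := by
      simpa using (hy.const_mul K).sqrt
    exact squeeze_zero (fun _ => norm_nonneg _) (fun k => Real.le_sqrt_of_sq_le (hQK _)) h
  obtain ⟨z₀, hz₀⟩ := hfix
  have hstep : Tendsto (fun k => x (k + 1) - x k) atTop (𝓝 0) := by
    refine hconv _ ?_
    have hlim := tendsto_atTop_ciInf (hanti z₀ hz₀)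
      ⟨0, by rintro _ ⟨k, rfl⟩; exact hQnn _⟩
    have hdiff := hlim.sub (hlim.comp (tendsto_add_atTop_nat 1))
    rw [sub_self] at hdiff
    refine squeeze_zero (fun _ => hQnn _) (fun k => ?_) hdiff
    have := hfejer z₀ hz₀ k
    simp only [Function.comp_apply]
    linarith
  have hbdd : ∀ k, x k ∈ Metric.closedBall z₀ √(K * Q (x 0 - z₀)) := fun k => by
    rw [mem_closedBall_iff_norm]
    refine Real.le_sqrt_of_sq_le ((hQK _).trans ?_)
    exact mul_le_mul_of_nonneg_left (hanti z₀ hz₀ (Nat.zero_le k)) hK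
  obtain ⟨z, -, φ, hφ, hz⟩ := (isCompact_closedBall z₀ _).tendsto_subseq hbdd
  have hz' : Tendsto (fun k => x (φ k + 1)) atTop (𝓝 z) := by
    simpa using hz.add (hstep.comp hφ.tendsto_atTop)
  have hRz : R z z := hR.mem_of_tendsto (hz.prodMk_nhds hz') (Eventually.of_forall fun k => hx _)
  refine ⟨z, hRz, ?_⟩
  rw [← tendsto_sub_nhds_zero_iff]
  refine hconv _ ?_
  have hsub : Tendsto (fun k => Q (x (φ k) - z)) atTop (𝓝 0) := by
    have := (hQ.tendsto _).comp (hz.sub_const z)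
    simpa [Function.comp_def, hQ0] using this
  exact (tendsto_iff_tendsto_subseq_of_antitone (hanti z hRz) hφ.tendsto_atTop).2 hsub

theorem IsADALRun.exists_convergesTo {N : ℕ} {lam μ₁ μ₂ : ℝ} (hlam : 0 ≤ lam) (hμ₁ : 0 < μ₁)
    (hμ₂ : 0 < μ₂) {b : Fin N → ℝ} {Dx Dy P : Matrix (Fin N) (Fin N) ℝ} (hP : Pᵀ * P = 1)
    {w : ℕ → State N} (hw : IsADALRun lam μ₁ μ₂ b Dx Dy P w) :
    ∃ z : State N, IsKuhnTucker lam b Dx Dy P z ∧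
      z.u - b + (Dxᵀ *ᵥ z.gx + Pᵀ *ᵥ z.gz) = 0 ∧ ConvergesTo w z := by
  have hstep k := (hw k).isOptimalStep hlam hμ₁ hμ₂ hP
  obtain ⟨z, hz, hlim⟩ := exists_tendsto_of_fejer (x := fun k => (w (k + 1)).carried)
    (continuous_energy (μ₁ := μ₁) (μ₂ := μ₂) (Dx := Dx) (P := P)) energy_zero
    (by positivity : 0 ≤ μ₁ + μ₂ + 1 / μ₁ + 1 / μ₂) (norm_sq_le_energy hμ₁ hμ₂ hP)
    (energy_nonneg hμ₁ hμ₂) (R := IsOptimalStep lam μ₁ μ₂ b Dx Dy P)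
    isClosed_isOptimalStep (fun k => (hstep (k + 1)).1)
    (by
      obtain ⟨z, ⟨⟨h₁, h₂, h₃⟩, hx, hy, -, hv⟩, hu⟩ :=
        exists_isKuhnTucker (b := b) (Dx := Dx) (Dy := Dy) (P := P) hlam
      refine ⟨z.carried, ?_, ?_, hy, hu, ?_⟩
      · simpa [nextDx, State.carried, ← h₁] using hx
      · simpa [State.carried] using sub_eq_zero.1 hv
      · simpa [nextV, State.carried, ← h₃] using h₂)
    (fun z hz k => (hstep k).1.energy_le hμ₁ hμ₂ (hstep (k + 1)).1 hz)
  have hlim' : Tendsto (fun k => (w k).carried) atTop (𝓝 z) := (tendsto_add_atTop_iff_nat 1).1 hlim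
  have hpair := hlim'.prodMk_nhds hlim
  have hdx : Tendsto (fun k => (w k).dx) atTop (𝓝 (nextDx μ₁ Dx z z)) := by
    rw [← tendsto_add_atTop_iff_nat 1]
    have hc : Continuous fun p : Carried N × Carried N => nextDx μ₁ Dx p.1 p.2 := by
      unfold nextDx; fun_prop
    simpa only [Function.comp_def, ← (hstep _).2.1] using (hc.tendsto (z, z)).comp hpair
  have hv : Tendsto (fun k => (w k).v) atTop (𝓝 (nextV μ₂ P z z)) := by
    rw [← tendsto_add_atTop_iff_nat 1]
    have hc : Continuous fun p : Carried N × Carried N => nextV μ₂ P p.1 p.2 := by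
      unfold nextV; fun_prop
    simpa only [Function.comp_def, ← (hstep _).2.2] using (hc.tendsto (z, z)).comp hpair
  refine ⟨⟨nextDx μ₁ Dx z z, z.2.1, z.1, nextV μ₂ P z z, z.2.2.1, z.2.2.2.1, z.2.2.2.2⟩,
    ⟨⟨?_, ?_, ?_⟩, ?_, hz.dy, ?_, ?_⟩, hz.u, hdx, hlim'.snd_nhds.fst_nhds, hlim'.fst_nhds, hv,
    hlim'.snd_nhds.snd_nhds.fst_nhds, hlim'.snd_nhds.snd_nhds.snd_nhds.fst_nhds,
    hlim'.snd_nhds.snd_nhds.snd_nhds.snd_nhds⟩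
  · simp [nextDx]
  · simpa using hz.gy
  · simp [nextV]
  · simpa using hz.dx
  · rw [← eq_neg_of_add_eq_zero_left hz.u]
    exact isSubgradient_half_sqNorm_sub b z.1
  · simpa [sub_eq_zero] using hz.v

theorem ConvergesTo.tendsto_output {N : ℕ} {P : Matrix (Fin N) (Fin N) ℝ} (hP : Pᵀ * P = 1)
    {w : ℕ → State N} {z : State N} (h : ConvergesTo w z) (hz : z.v = P *ᵥ z.u) :
    Tendsto (fun k => output P (w k)) atTop (𝓝 z.u) := by
  obtain ⟨-, -, hu, hv, -⟩ := h
  have hc : Continuous fun p : (Fin N → ℝ) × (Fin N → ℝ) =>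
      (1 / 2 : ℝ) • (p.1 + Pᵀ *ᵥ p.2) := by fun_prop
  have hlim := (hc.tendsto (z.u, z.v)).comp (hu.prodMk_nhds hv)
  have e : (1 / 2 : ℝ) • (z.u + Pᵀ *ᵥ z.v) = z.u := by
    rw [hz, Matrix.mulVec_mulVec, hP, Matrix.one_mulVec]
    module
  rw [e] at hlim
  exact hlim

end TVDenoise

theorem mainTheorem1 (n m : ℕ) (lam μ₁ μ₂ : ℝ) (hlam : 0 ≤ lam) (hμ₁ : 0 < μ₁) (hμ₂ : 0 < μ₂)
    (b : Fin (n * m) → ℝ) (Sx Sy : Finset (Fin (n * m)))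
    (Dx Dy P : Matrix (Fin (n * m)) (Fin (n * m)) ℝ)
    (hDx : Dx = TVDenoise.diffMatrix (n * m) Sx)
    (hDy : Dy = TVDenoise.diffMatrix (n * m) Sy)
    (hP : P = TVDenoise.reorder n m) :
    ((TVDenoise.uMatrix μ₁ μ₂ Dx).PosDef ∧
      TVDenoise.IsTridiagonal (TVDenoise.uMatrix μ₁ μ₂ Dx)) ∧
    ((TVDenoise.vMatrix μ₁ μ₂ Dy).PosDef ∧
      TVDenoise.IsTridiagonal (TVDenoise.vMatrix μ₁ μ₂ Dy)) ∧
    (∀ w₀ : TVDenoise.State (n * m),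
      ∃! w : ℕ → TVDenoise.State (n * m),
        w 0 = w₀ ∧ TVDenoise.IsADALRun lam μ₁ μ₂ b Dx Dy P w) ∧
    (∀ w : ℕ → TVDenoise.State (n * m), TVDenoise.IsADALRun lam μ₁ μ₂ b Dx Dy P w →
      ∃ z : TVDenoise.State (n * m),
        TVDenoise.IsKuhnTucker lam b Dx Dy P z ∧
        TVDenoise.ConvergesTo w z ∧
        TVDenoise.IsSplitSolution lam b Dx Dy P z ∧
        (∀ u : Fin (n * m) → ℝ, u ≠ z.u →
          TVDenoise.tvObjective lam b Dx Dy P z.u < TVDenoise.tvObjective lam b Dx Dy P u) ∧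
        Tendsto (fun k => TVDenoise.output P (w k)) atTop (𝓝 z.u)) := by
  subst hDx hDy
  have hPP : Pᵀ * P = 1 := hP ▸ TVDenoise.reorder_transpose_mul n m
  refine ⟨⟨TVDenoise.posDef_gram_add_smul _ (add_pos (div_pos hμ₁ hμ₂) hμ₁),
      TVDenoise.isTridiagonal_gram_add_smul _ _ _⟩,
    ⟨TVDenoise.posDef_gram_add_smul _ (div_pos hμ₁ hμ₂),
      TVDenoise.isTridiagonal_gram_add_smul _ _ _⟩,
    TVDenoise.existsUnique_isADALRun lam hμ₁ hμ₂ b _ _ P, fun w hw => ?_⟩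
  obtain ⟨z, hz, hgrad, hlim⟩ := hw.exists_convergesTo hlam hμ₁ hμ₂ hPP
  exact ⟨z, hz, hlim, hz.isSplitSolution, fun u hu => hz.tvObjective_lt hgrad hu,
    hlim.tendsto_output hPP hz.1.2.2⟩
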